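/- Let $\kappa$ be an infinite cardinal and let $n\ge 7$. Let $G$ be a limit of regular representations of length $\kappa$ with base $\mathrm{Sym}(n)$, i.e. $G=\bigcup_{\alpha<\kappa}G_\alpha$ for an increasing chain of subgroups $(G_\alpha)_{\alpha<\kappa}$ such that $G_0\cong \mathrm{Sym}(n)$; for every $\alpha<\kappa$ the group $G_{\alpha+1}$ is identified with the full symmetric group $\mathrm{Sym}(G_\alpha)$ so that the inclusion $G_\alpha\le G_{\alpha+1}$ is the right regular representation $x\mapsto(y\mapsto yx^{-1})$ (permutations being composed as functions); and $G_\gamma=\bigcup_{\alpha<\gamma}G_\alpha$ for every limit ordinal $\gamma<\kappa$. Write $\iota_g(x)=gxg^{-1}$. Let $A\subseteq\kappa$ be a closed unbounded set with increasing enumeration $(a_\alpha)_{\alpha<\kappa}$ of length $\kappa$, and let $\mathrm{Aut}_A(G)$ be the group of all automorphisms $\varphi$ of $G$ with $\varphi[G_\alpha]=G_\alpha$ for all $\alpha\in A$, under composition. Put $$\mathcal G_A=\prod_{\alpha<\kappa,\ \alpha\text{ non-limit}}\mathbf C_{G_{a_\alpha}}(G_{a_{\alpha-1}}),$$ where $0$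 counts as a non-limit ordinal and $G_{a_{-1}}=\{1\}$. For $\mathbf g=(g_\alpha)\in\mathcal G_A$ define automorphisms $\Phi^{\mathbf g}_\alpha$ of $G$ $(\alpha<\kappa)$ recursively: $\Phi^{\mathbf g}_0=\iota_{g_0}$; $\Phi^{\mathbf g}_{\alpha+1}=\iota_{g_{\alpha+1}}\circ\Phi^{\mathbf g}_\alpha$; and for limit $\gamma$, $\Phi^{\mathbf g}_\gamma=\iota_{\psi}$, where $\psi\in G_{a_\gamma+1}=\mathrm{Sym}(G_{a_\gamma})$ is the permutation of $G_{a_\gamma}$ that agrees with $\Phi^{\mathbf g}_\alpha$ on $G_{a_\alpha}$ for all $\alpha<\gamma$. Each $\Phi^{\mathbf g}_\alpha$ maps $G_{a_\delta}$ onto itself for $\alpha\le\delta<\kappa$, and $\Phi^{\mathbf g}_\alpha$ agrees with $\Phi^{\mathbf g}_\beta$ on $G_{a_\beta}$ for $\beta\le\alpha$. Let $\Theta(\mathbf g)=\Phi^{\mathbf g}\in\mathrm{Aut}_A(G)$ be the automorphism that agrees with $\Phi^{\mathbf g}_\alpha$ on $G_{a_\alpha}$ for all $\alpha<\kappa$.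 The set $\mathcal G_A$ is a group under $$(\mathbf g\cdot\mathbf h)_\alpha=g_\alpha\,\Phi^{\mathbf g}_{\alpha-1}(h_\alpha),\qquad \Phi^{\mathbf g}_{-1}=\mathrm{id}.$$ **Theorem.** If $a_\alpha$ is not a limit ordinal whenever $\alpha<\kappa$ is not a limit ordinal, then $\Theta:\mathcal G_A\to\mathrm{Aut}_A(G)$ is an isomorphism of groups. -/

import Mathlib

open Set Order Cardinal

universe u

/-- The data that exhibit a group `G` as the limit of regular representations of length
`κ` with base `Sym(n)`, presented as the union of its increasing chain of subgroups
`G_α = level α`, `α < κ`.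

* `G_0` is isomorphic to `Sym(n)`;
* `G_{α+1}` is identified with `Sym(G_α)` (by `succEquiv`) in such a way that the inclusion
  `G_α ≤ G_{α+1}` becomes the right regular representation `x ↦ (y ↦ y * x⁻¹)`.  (Permutations are
  composed as functions, `(σ * τ) y = σ (τ y)`, so the inverse makes this a homomorphism.)
* `G_γ` is the union of the earlier `G_β` for limit `γ < κ`, and `G` is the union of all `G_α`.

Only the values of `level` at ordinals `α < κ` are constrained or used. -/
structure RegularRepLimit (κ : Cardinal.{u}) (n : ℕ) (G : Type u) [Group G] where
  /-- the length is an infinite cardinal -/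
  aleph0_le : ℵ₀ ≤ κ
  /-- the subgroups `G_α` -/
  level : Ordinal.{u} → Subgroup G
  level_mono : ∀ α β : Ordinal.{u}, α ≤ β → β < κ.ord → level α ≤ level β
  base : Nonempty (level 0 ≃* Equiv.Perm (Fin n))
  /-- the identification `G_{α+1} = Sym(G_α)` -/
  succEquiv : ∀ α : Ordinal.{u}, α < κ.ord → (level (α + 1) ≃* Equiv.Perm (level α))
  succEquiv_inclusion : ∀ (α : Ordinal.{u}) (hα : α < κ.ord) (h : level α ≤ level (α + 1))
    (x : level α), succEquiv α hα (Subgroup.inclusion h x) = Equiv.mulRight x⁻¹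
  mem_level_limit : ∀ γ : Ordinal.{u}, γ < κ.ord → IsSuccLimit γ →
    ∀ x : G, x ∈ level γ ↔ ∃ β < γ, x ∈ level β
  exists_mem_level : ∀ x : G, ∃ α < κ.ord, x ∈ level α

/-- `A` is a club subset of `κ` and `α ↦ enum α`, `α < κ`, is the increasing enumeration of `A`,
of length `κ`.  (For regular `κ` every club subset of `κ` has such an enumeration; in all cases it
is unique on `κ`.  Only the values at ordinals `α < κ` are constrained or used.) -/
structure ClubEnumeration (κ : Cardinal.{u}) (A : Set (Set.Iio κ.ord)) where
  isClub : IsClub A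
  /-- the enumeration `α ↦ a_α` -/
  enum : Ordinal.{u} → Ordinal.{u}
  strictMonoOn : StrictMonoOn enum (Set.Iio κ.ord)
  image_eq : enum '' Set.Iio κ.ord = Subtype.val '' A

namespace ClubEnumeration

variable {κ : Cardinal.{u}} {A : Set (Set.Iio κ.ord)} (a : ClubEnumeration κ A)

theorem enum_lt {α : Ordinal.{u}} (h : α < κ.ord) : a.enum α < κ.ord := by
  have : a.enum α ∈ Subtype.val '' A := a.image_eq ▸ ⟨α, h, rfl⟩
  obtain ⟨x, -, hx⟩ := this
  exact hx ▸ x.2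

theorem enum_mono {α β : Ordinal.{u}} (h : α ≤ β) (hβ : β < κ.ord) : a.enum α ≤ a.enum β :=
  a.strictMonoOn.monotoneOn (h.trans_lt hβ : α ∈ Set.Iio κ.ord) hβ h

theorem le_enum {α : Ordinal.{u}} (h : α < κ.ord) : α ≤ a.enum α := by
  induction α using WellFoundedLT.induction with
  | ind α ih =>
    refine le_of_forall_lt fun β hβ => ?_
    exact (ih β hβ (hβ.trans h)).trans_lt
      (a.strictMonoOn (hβ.trans h : β ∈ Set.Iio κ.ord) h hβ)

theorem exists_lt_enum {γ : Ordinal.{u}} (hγ : γ < κ.ord) (hl : IsSuccLimit γ)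
    {β : Ordinal.{u}} (hβ : β < a.enum γ) : ∃ α < γ, β < a.enum α := by
  by_contra! hcon
  let B : Set Ordinal.{u} := {b | ∀ α < γ, a.enum α ≤ b}
  have hB : B.Nonempty := ⟨β, hcon⟩
  let s := sInf B
  have hsB : s ∈ B := csInf_mem hB
  have hsβ : s ≤ β := csInf_le' hcon
  have hsκ : s < κ.ord := (hsβ.trans_lt hβ).trans (a.enum_lt hγ)
  let t : Set (Set.Iio κ.ord) := {x | ∃ α < γ, x.1 = a.enum α}
  have htA : t ⊆ A := by
    rintro x ⟨α, hα, hx⟩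
    have : a.enum α ∈ Subtype.val '' A := a.image_eq ▸ ⟨α, hα.trans hγ, rfl⟩
    obtain ⟨y, hy, hyx⟩ := this
    have : x = y := Subtype.ext (hx.trans hyx.symm)
    exact this ▸ hy
  have ht0 : t.Nonempty :=
    ⟨⟨a.enum 0, a.enum_lt (hl.bot_lt.trans hγ)⟩, 0, hl.bot_lt, rfl⟩
  have hlub : IsLUB t ⟨s, hsκ⟩ := by
    constructor
    · rintro x ⟨α, hα, hx⟩
      exact Subtype.coe_le_coe.1 (hx.le.trans (hsB α hα))
    · intro y hy
      refine Subtype.coe_le_coe.1 (csInf_le' fun α hα => ?_)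
      exact Subtype.coe_le_coe.2
        (hy (show (⟨a.enum α, a.enum_lt (hα.trans hγ)⟩ : Set.Iio κ.ord) ∈ t from ⟨α, hα, rfl⟩))
  have hsA : (⟨s, hsκ⟩ : Set.Iio κ.ord) ∈ A := a.isClub.isLUB_mem htA ht0 hlub
  have : s ∈ a.enum '' Set.Iio κ.ord := a.image_eq ▸ ⟨_, hsA, rfl⟩
  obtain ⟨δ, hδ, hδs⟩ := this
  have hγδ : γ ≤ δ := by
    refine le_of_forall_lt fun α hα => ?_
    have h1 : α + 1 < γ := hl.add_one_lt hα
    have h2 : a.enum α < a.enum (α + 1) :=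
      a.strictMonoOn (hα.trans hγ : α ∈ Set.Iio κ.ord) (h1.trans hγ)
        (Order.lt_add_one_iff.2 le_rfl)
    have h3 : a.enum α < a.enum δ := hδs ▸ h2.trans_le (hsB _ h1)
    exact (a.strictMonoOn.lt_iff_lt (hα.trans hγ : α ∈ Set.Iio κ.ord) hδ).1 h3
  have := a.enum_mono hγδ hδ
  rw [hδs] at this
  exact absurd (this.trans hsβ) (not_le.2 hβ)

theorem isSuccLimit_enum {γ : Ordinal.{u}} (hγ : γ < κ.ord) (hl : IsSuccLimit γ) :
    IsSuccLimit (a.enum γ) := by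
  rw [Order.isSuccLimit_iff_of_orderBot, Order.isSuccPrelimit_iff_succ_lt]
  constructor
  · exact (lt_of_lt_of_le hl.bot_lt (a.le_enum hγ)).ne'
  · intro β hβ
    obtain ⟨α, hα, h⟩ := a.exists_lt_enum hγ hl hβ
    exact (Order.succ_le_of_lt h).trans_lt
      (a.strictMonoOn (hα.trans hγ : α ∈ Set.Iio κ.ord) hγ hα)

end ClubEnumeration

namespace RegularRepLimit

variable {κ : Cardinal.{u}} {n : ℕ} {G : Type u} [Group G] (S : RegularRepLimit κ n G)
  {A : Set (Set.Iio κ.ord)} (a : ClubEnumeration κ A)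

/-- The group `Aut_C(G)` of `C`-level preserving automorphisms: those automorphisms `φ` of `G` with
`φ[G_α] = G_α` for all `α ∈ C`. -/
def levelPreservingAut (C : Set (Set.Iio κ.ord)) : Subgroup (MulAut G) where
  carrier := {φ | ∀ α ∈ C, φ '' (S.level α : Set G) = S.level α}
  one_mem' := by intro α _; simp
  mul_mem' := by
    intro φ ψ hφ hψ α hα
    rw [MulAut.coe_mul, Set.image_comp, hψ α hα, hφ α hα]
  inv_mem' := by
    intro φ hφ α hα
    conv_lhs => rw [← hφ α hα]
    rw [← Set.image_comp, ← MulAut.coe_mul]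
    simp

/-- The subgroup `G_{a_{α-1}}`, where `G_{a_{-1}}` is trivial (used for non-limit `α`). -/
noncomputable def prevLevel (α : Ordinal.{u}) : Subgroup G :=
  if α = 0 then ⊥ else S.level (a.enum (Ordinal.pred α))

/-- The centralizer of `G_{a_{α-1}}` in `G_{a_α}` (used for non-limit `α`). -/
noncomputable def component (α : Ordinal.{u}) : Subgroup G :=
  S.level (a.enum α) ⊓ Subgroup.centralizer (S.prevLevel a α : Set G)

/-- The underlying set of `𝒢_A`: the families `(g_α)`, indexed by the non-limit ordinals `α < κ`
(`0` is a non-limit ordinal), with `g_α` in the centralizer of `G_{a_{α-1}}` in `G_{a_α}`. -/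
@[ext]
structure TransfiniteProduct where
  /-- the coordinates of the family -/
  coord : ∀ α : {α : Ordinal.{u} // α < κ.ord ∧ ¬ IsSuccLimit α}, S.component a α

/-- `s` is the permutation of `G_{a_γ}` that agrees on `G_{a_β}` with the given `f β`,
for all `β < γ`; that is, `s` is the limit of the restrictions of the `f β` to `G_{a_β}`. -/
def IsGluing (γ : Ordinal.{u}) (f : ∀ β < γ, MulAut G)
    (s : Equiv.Perm (S.level (a.enum γ))) : Prop :=
  ∀ (β : Ordinal.{u}) (hβ : β < γ) (x : S.level (a.enum γ)),
    (x : G) ∈ S.level (a.enum β) → ((s x : S.level (a.enum γ)) : G) = f β hβ x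

open Classical in
/-- The element of `G_{a_γ + 1}` that corresponds under `G_{a_γ + 1} = Sym(G_{a_γ})` to the limit
of the restrictions of the `f β` to `G_{a_β}`, `β < γ`. In the construction below this limit
always exists for limit `γ < κ` (see `exists_isGluing_phi`), so that the value `1` is not used. -/
noncomputable def gluedElement (γ : Ordinal.{u}) (f : ∀ β < γ, MulAut G) : G :=
  if h : a.enum γ < κ.ord ∧ ∃ s, S.IsGluing a γ f s then
    ((S.succEquiv (a.enum γ) h.1).symm h.2.choose : G)
  else 1

namespace TransfiniteProduct

variable {S a}

open Classical in
/-- The coordinate `g_α` as an element of `G` (and `1` where `α` is not an index). -/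
noncomputable def val (g : S.TransfiniteProduct a) (α : Ordinal.{u}) : G :=
  if h : α < κ.ord ∧ ¬ IsSuccLimit α then g.coord ⟨α, h⟩ else 1

/-- The automorphisms `Φ_α` of `G` attached to a family `g`: `Φ_0` is conjugation by `g_0`,
`Φ_{α+1}` is `Φ_α` followed by conjugation by `g_{α+1}`, and for limit `γ`, `Φ_γ` is conjugation
by the element of `G_{a_γ + 1} = Sym(G_{a_γ})` given by the limit of the restrictions of the `Φ_β`
to `G_{a_β}`, `β < γ`.  Here conjugation by `g` is `x ↦ g * x * g⁻¹`. -/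
noncomputable def phi (g : S.TransfiniteProduct a) (α : Ordinal.{u}) : MulAut G :=
  Ordinal.limitRecOn (motive := fun _ => MulAut G) α
    (MulAut.conj (g.val 0))
    (fun β Φβ => MulAut.conj (g.val (β + 1)) * Φβ)
    (fun γ _ Φ => MulAut.conj (S.gluedElement a γ Φ))

/-- `Φ_{α-1}`, with `Φ_{-1} = 1` (used for non-limit `α`). -/
noncomputable def phiPrev (g : S.TransfiniteProduct a) (α : Ordinal.{u}) : MulAut G :=
  if α = 0 then 1 else g.phi (Ordinal.pred α)

@[simp] theorem phi_zero (g : S.TransfiniteProduct a) : g.phi 0 = MulAut.conj (g.val 0) := by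
  simp [phi]

@[simp] theorem phi_add_one (g : S.TransfiniteProduct a) (α : Ordinal.{u}) :
    g.phi (α + 1) = MulAut.conj (g.val (α + 1)) * g.phi α := by
  simp [phi]

theorem phi_limit (g : S.TransfiniteProduct a) {γ : Ordinal.{u}} (hl : IsSuccLimit γ) :
    g.phi γ = MulAut.conj (S.gluedElement a γ fun β _ => g.phi β) := by
  simp [phi, hl]

theorem val_mem (g : S.TransfiniteProduct a) (α : Ordinal.{u}) : g.val α ∈ S.component a α := by
  unfold val
  split_ifs with h
  · exact (g.coord ⟨α, h⟩).2
  · exact one_mem _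

end TransfiniteProduct

theorem add_one_lt (S : RegularRepLimit κ n G) {α : Ordinal.{u}} (h : α < κ.ord) : α + 1 < κ.ord :=
  (Cardinal.isSuccLimit_ord S.aleph0_le).add_one_lt h

theorem level_le_add_one {α : Ordinal.{u}} (h : α < κ.ord) : S.level α ≤ S.level (α + 1) :=
  S.level_mono _ _ (Order.lt_add_one_iff.2 le_rfl).le (S.add_one_lt h)

theorem level_enum_mono {α β : Ordinal.{u}} (h : α ≤ β) (hβ : β < κ.ord) :
    S.level (a.enum α) ≤ S.level (a.enum β) :=
  S.level_mono _ _ (a.enum_mono h hβ) (a.enum_lt hβ)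

theorem mem_level_enum_limit {γ : Ordinal.{u}} (hγ : γ < κ.ord) (hl : IsSuccLimit γ) {x : G}
    (hx : x ∈ S.level (a.enum γ)) : ∃ β < γ, x ∈ S.level (a.enum β) := by
  obtain ⟨β, hβ, hxβ⟩ :=
    (S.mem_level_limit _ (a.enum_lt hγ) (a.isSuccLimit_enum hγ hl) x).1 hx
  obtain ⟨α, hα, h⟩ := a.exists_lt_enum hγ hl hβ
  exact ⟨α, hα, S.level_mono _ _ h.le (a.enum_lt (hα.trans hγ)) hxβ⟩

theorem exists_mem_level_enum (x : G) : ∃ α < κ.ord, x ∈ S.level (a.enum α) := by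
  obtain ⟨α, hα, hx⟩ := S.exists_mem_level x
  exact ⟨α, hα, S.level_mono _ _ (a.le_enum hα) (a.enum_lt hα) hx⟩

theorem conj_succEquiv_symm {α : Ordinal.{u}} (hα : α < κ.ord) (s : Equiv.Perm (S.level α))
    (hs : ∀ x y, s (x * y) = s x * s y) (x : S.level α) :
    MulAut.conj (((S.succEquiv α hα).symm s : S.level (α + 1)) : G) (x : G) = (s x : G) := by
  have hle := S.level_le_add_one hα
  have key : (S.succEquiv α hα).symm s * Subgroup.inclusion hle x *
      ((S.succEquiv α hα).symm s)⁻¹ = Subgroup.inclusion hle (s x) := by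
    apply (S.succEquiv α hα).injective
    simp only [map_mul, map_inv, MulEquiv.apply_symm_apply, S.succEquiv_inclusion]
    rw [mul_inv_eq_iff_eq_mul]
    have hs1 : s 1 = 1 := by simpa using hs 1 1
    have hsinv : ∀ z, s z⁻¹ = (s z)⁻¹ := fun z =>
      eq_inv_of_mul_eq_one_left (by rw [← hs]; simp [hs1])
    ext1 y
    simp [hs, hsinv]
  have := congrArg (Subtype.val) key
  simpa [MulAut.conj_apply] using this

theorem isGluing_unique {γ : Ordinal.{u}} (hγ : γ < κ.ord) (hl : IsSuccLimit γ)
    {f : ∀ β < γ, MulAut G} {s t : Equiv.Perm (S.level (a.enum γ))}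
    (hs : S.IsGluing a γ f s) (ht : S.IsGluing a γ f t) : s = t := by
  ext x
  obtain ⟨β, hβ, hx⟩ := S.mem_level_enum_limit a hγ hl x.2
  rw [hs β hβ x hx, ht β hβ x hx]

theorem gluedElement_eq {γ : Ordinal.{u}} (hγ : γ < κ.ord) (hl : IsSuccLimit γ)
    {f : ∀ β < γ, MulAut G} {s : Equiv.Perm (S.level (a.enum γ))} (hs : S.IsGluing a γ f s) :
    S.gluedElement a γ f = ((S.succEquiv (a.enum γ) (a.enum_lt hγ)).symm s : G) := by
  have h : a.enum γ < κ.ord ∧ ∃ s, S.IsGluing a γ f s := ⟨a.enum_lt hγ, s, hs⟩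
  rw [gluedElement, dif_pos h, S.isGluing_unique a hγ hl h.2.choose_spec hs]

theorem isGluing_map_mul {γ : Ordinal.{u}} (hγ : γ < κ.ord) (hl : IsSuccLimit γ)
    {f : ∀ β < γ, MulAut G} {s : Equiv.Perm (S.level (a.enum γ))} (hs : S.IsGluing a γ f s)
    (x y : S.level (a.enum γ)) : s (x * y) = s x * s y := by
  obtain ⟨β, hβ, hx⟩ := S.mem_level_enum_limit a hγ hl x.2
  obtain ⟨β', hβ', hy⟩ := S.mem_level_enum_limit a hγ hl y.2
  have hm : max β β' < γ := max_lt hβ hβ'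
  have hx' := S.level_enum_mono a (le_max_left β β') (hm.trans hγ) hx
  have hy' := S.level_enum_mono a (le_max_right β β') (hm.trans hγ) hy
  ext
  rw [hs _ hm (x * y) (mul_mem hx' hy'), Subgroup.coe_mul, Subgroup.coe_mul, map_mul,
    hs _ hm x hx', hs _ hm y hy']

theorem exists_isGluing {γ : Ordinal.{u}} (hγ : γ < κ.ord) (hl : IsSuccLimit γ)
    (f : ∀ β < γ, MulAut G)
    (hf : ∀ (β : Ordinal.{u}) (hβ : β < γ) (x : G),
      f β hβ x ∈ S.level (a.enum β) ↔ x ∈ S.level (a.enum β))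
    (hc : ∀ (α β : Ordinal.{u}) (hα : α < γ) (hβ : β < γ), β ≤ α →
      ∀ x ∈ S.level (a.enum β), f α hα x = f β hβ x) :
    ∃ s, S.IsGluing a γ f s := by
  have hc2 : ∀ (α β : Ordinal.{u}) (hα : α < γ) (hβ : β < γ) (x : G),
      x ∈ S.level (a.enum α) → x ∈ S.level (a.enum β) → f α hα x = f β hβ x := by
    intro α β hα hβ x hxα hxβ
    rcases le_total α β with h | h
    · exact (hc β α hβ hα h x hxα).symm
    · exact hc α β hα hβ h x hxβ
  choose i hi hxi using fun x : S.level (a.enum γ) => S.mem_level_enum_limit a hγ hl x.2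
  have hmem : ∀ (β : Ordinal.{u}), β < γ → ∀ x ∈ S.level (a.enum β), x ∈ S.level (a.enum γ) :=
    fun β hβ x hx => S.level_enum_mono a hβ.le hγ hx
  let s : S.level (a.enum γ) → S.level (a.enum γ) := fun x =>
    ⟨f (i x) (hi x) x, hmem _ (hi x) _ ((hf _ (hi x) _).2 (hxi x))⟩
  have hs : ∀ (β : Ordinal.{u}) (hβ : β < γ) (x : S.level (a.enum γ)),
      (x : G) ∈ S.level (a.enum β) → (s x : G) = f β hβ x := fun β hβ x hx =>
    hc2 _ _ _ _ _ (hxi x) hx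
  have hbij : Function.Bijective s := by
    constructor
    · intro x y hxy
      have hm : max (i x) (i y) < γ := max_lt (hi x) (hi y)
      have hx' := S.level_enum_mono a (le_max_left (i x) (i y)) (hm.trans hγ) (hxi x)
      have hy' := S.level_enum_mono a (le_max_right (i x) (i y)) (hm.trans hγ) (hxi y)
      have := congrArg Subtype.val hxy
      rw [hs _ hm x hx', hs _ hm y hy'] at this
      exact Subtype.ext ((f _ hm).injective this)
    · intro y
      have hy : (f (i y) (hi y))⁻¹ (y : G) ∈ S.level (a.enum (i y)) := by
        rw [← hf _ (hi y), MulAut.apply_inv_self]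
        exact hxi y
      refine ⟨⟨_, hmem _ (hi y) _ hy⟩, Subtype.ext ?_⟩
      rw [hs _ (hi y) _ hy, MulAut.apply_inv_self]
  exact ⟨Equiv.ofBijective s hbij, hs⟩

namespace TransfiniteProduct

variable {S a}

theorem conj_mem_iff {H : Subgroup G} {g : G} (hg : g ∈ H) (x : G) :
    MulAut.conj g x ∈ H ↔ x ∈ H := by
  rw [MulAut.conj_apply, H.mul_mem_cancel_right (H.inv_mem hg), H.mul_mem_cancel_left hg]

theorem conj_val_add_one (g : S.TransfiniteProduct a) (α : Ordinal.{u}) {x : G}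
    (hx : x ∈ S.level (a.enum α)) : MulAut.conj (g.val (α + 1)) x = x := by
  have h := (g.val_mem (α + 1)).2
  have h0 : α + 1 ≠ 0 := (Order.bot_lt_succ α).ne'
  rw [prevLevel, if_neg h0, Ordinal.pred_add_one] at h
  have h := Subgroup.mem_centralizer_iff.1 h
  rw [MulAut.conj_apply, mul_inv_eq_iff_eq_mul]
  exact (h x hx).symm

theorem phi_props (g : S.TransfiniteProduct a) {α : Ordinal.{u}} (hα : α < κ.ord) :
    (∀ δ, α ≤ δ → δ < κ.ord → ∀ x,
      g.phi α x ∈ S.level (a.enum δ) ↔ x ∈ S.level (a.enum δ)) ∧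
    (∀ β, β ≤ α → ∀ x ∈ S.level (a.enum β), g.phi α x = g.phi β x) := by
  induction α using Ordinal.limitRecOn with
  | zero =>
    refine ⟨fun δ _ hδ x => ?_, fun β hβ x _ => ?_⟩
    · rw [phi_zero]
      exact conj_mem_iff (S.level_enum_mono a zero_le hδ (g.val_mem 0).1) x
    · rw [nonpos_iff_eq_zero.1 hβ]
  | add_one α ih =>
    have hlt : α < α + 1 := Order.lt_add_one_iff.2 le_rfl
    have hα' : α < κ.ord := hlt.trans hα
    obtain ⟨ih1, ih2⟩ := ih hα'
    refine ⟨fun δ hδ hδκ x => ?_, fun β hβ x hx => ?_⟩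
    · rw [phi_add_one, MulAut.mul_apply,
        conj_mem_iff (S.level_enum_mono a hδ hδκ (g.val_mem _).1)]
      exact ih1 δ (hlt.le.trans hδ) hδκ x
    · rcases hβ.eq_or_lt with rfl | hβ
      · rfl
      · have hβ : β ≤ α := Order.lt_add_one_iff.1 hβ
        have hx' : x ∈ S.level (a.enum α) := S.level_enum_mono a hβ hα' hx
        rw [phi_add_one, MulAut.mul_apply, conj_val_add_one, ih2 β hβ x hx]
        exact (ih1 α le_rfl hα' x).2 hx'
  | limit γ hl ih =>
    obtain ⟨s, hs⟩ := S.exists_isGluing a hα hl (fun β _ => g.phi β)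
      (fun β hβ x => (ih β hβ (hβ.trans hα)).1 β le_rfl (hβ.trans hα) x)
      (fun α β hα' hβ h x hx => (ih α hα' (hα'.trans hα)).2 β h x hx)
    have hphi : ∀ x : S.level (a.enum γ), g.phi γ x = (s x : G) := fun x => by
      rw [phi_limit g hl, S.gluedElement_eq a hα hl hs]
      exact S.conj_succEquiv_symm _ s (S.isGluing_map_mul a hα hl hs) x
    refine ⟨fun δ hδ hδκ x => ?_, fun β hβ x hx => ?_⟩
    · rcases hδ.eq_or_lt with rfl | hδ
      · constructor
        · intro hx
          have h1 : g.phi γ (s.symm ⟨_, hx⟩ : S.level (a.enum γ)) = g.phi γ x := by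
            rw [hphi]; simp
          exact (g.phi γ).injective h1 ▸ (s.symm ⟨_, hx⟩).2
        · intro hx
          rw [hphi ⟨x, hx⟩]
          exact (s ⟨x, hx⟩).2
      · rw [phi_limit g hl, S.gluedElement_eq a hα hl hs]
        refine conj_mem_iff ?_ x
        refine S.level_mono _ _ ?_ (a.enum_lt hδκ) (Subtype.mem _)
        exact Order.add_one_le_of_lt (a.strictMonoOn (hα : γ ∈ Set.Iio κ.ord) hδκ hδ)
    · rcases hβ.eq_or_lt with rfl | hβ
      · rfl
      · rw [hphi ⟨x, S.level_enum_mono a hβ.le hα hx⟩]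
        exact hs β hβ _ hx

theorem phi_mem_iff (g : S.TransfiniteProduct a) {α δ : Ordinal.{u}} (h : α ≤ δ)
    (hδ : δ < κ.ord) (x : G) :
    g.phi α x ∈ S.level (a.enum δ) ↔ x ∈ S.level (a.enum δ) :=
  (g.phi_props (h.trans_lt hδ)).1 δ h hδ x

theorem phi_eq_of_le (g : S.TransfiniteProduct a) {α β : Ordinal.{u}} (h : β ≤ α)
    (hα : α < κ.ord) {x : G} (hx : x ∈ S.level (a.enum β)) : g.phi α x = g.phi β x :=
  (g.phi_props hα).2 β h x hx

theorem phi_eq_phi (g : S.TransfiniteProduct a) {α β : Ordinal.{u}} (hα : α < κ.ord)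
    (hβ : β < κ.ord) {x : G} (hxα : x ∈ S.level (a.enum α)) (hxβ : x ∈ S.level (a.enum β)) :
    g.phi α x = g.phi β x := by
  rcases le_total α β with h | h
  · exact (g.phi_eq_of_le h hβ hxα).symm
  · exact g.phi_eq_of_le h hα hxβ

theorem exists_isGluing_phi (g : S.TransfiniteProduct a) {γ : Ordinal.{u}} (hγ : γ < κ.ord)
    (hl : IsSuccLimit γ) : ∃ s, S.IsGluing a γ (fun β _ => g.phi β) s :=
  S.exists_isGluing a hγ hl _
    (fun _ hβ x => g.phi_mem_iff le_rfl (hβ.trans hγ) x)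
    (fun _ _ hα _ h _ hx => g.phi_eq_of_le h (hα.trans hγ) hx)

theorem phiPrev_mem_iff (g : S.TransfiniteProduct a) {α δ : Ordinal.{u}} (h : α ≤ δ)
    (hδ : δ < κ.ord) (x : G) :
    g.phiPrev α x ∈ S.level (a.enum δ) ↔ x ∈ S.level (a.enum δ) := by
  unfold phiPrev
  split_ifs with h0
  · rfl
  · exact g.phi_mem_iff ((Ordinal.pred_le_self α).trans h) hδ x

theorem phiPrev_mem_prevLevel_iff (g : S.TransfiniteProduct a) {α : Ordinal.{u}}
    (hα : α < κ.ord) (x : G) : g.phiPrev α x ∈ S.prevLevel a α ↔ x ∈ S.prevLevel a α := by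
  unfold phiPrev prevLevel
  split_ifs with h0
  · rfl
  · exact g.phi_mem_iff le_rfl ((Ordinal.pred_le_self α).trans_lt hα) x

theorem phiPrev_mem_component_iff (g : S.TransfiniteProduct a) {α : Ordinal.{u}}
    (hα : α < κ.ord) (x : G) : g.phiPrev α x ∈ S.component a α ↔ x ∈ S.component a α := by
  unfold component
  rw [Subgroup.mem_inf, Subgroup.mem_inf, g.phiPrev_mem_iff le_rfl hα]
  refine and_congr_right fun _ => ?_
  rw [Subgroup.mem_centralizer_iff, Subgroup.mem_centralizer_iff]
  constructor
  · intro h y hy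
    apply (g.phiPrev α).injective
    rw [map_mul, map_mul]
    exact h _ ((g.phiPrev_mem_prevLevel_iff hα y).2 hy)
  · intro h y hy
    have hy' : (g.phiPrev α)⁻¹ y ∈ S.prevLevel a α := by
      rw [← g.phiPrev_mem_prevLevel_iff hα, MulAut.apply_inv_self]
      exact hy
    have := congrArg (g.phiPrev α) (h _ hy')
    simpa only [map_mul, MulAut.apply_inv_self] using this

noncomputable instance : One (S.TransfiniteProduct a) := ⟨⟨fun _ => 1⟩⟩

/-- The twisted multiplication `(g * h)_α = g_α * Φ^g_{α-1}(h_α)`. -/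
noncomputable instance : Mul (S.TransfiniteProduct a) :=
  ⟨fun g h => ⟨fun α => g.coord α *
    ⟨g.phiPrev α (h.coord α), (g.phiPrev_mem_component_iff α.2.1 _).2 (h.coord α).2⟩⟩⟩

noncomputable instance : Inv (S.TransfiniteProduct a) :=
  ⟨fun g => ⟨fun α => ⟨(g.phiPrev α)⁻¹ ((g.coord α)⁻¹ : S.component a α), by
    rw [← g.phiPrev_mem_component_iff α.2.1, MulAut.apply_inv_self]
    exact ((g.coord α)⁻¹).2⟩⟩⟩

theorem coord_mul (g h : S.TransfiniteProduct a)
    (α : {α : Ordinal.{u} // α < κ.ord ∧ ¬ IsSuccLimit α}) :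
    ((g * h).coord α : G) = g.coord α * g.phiPrev α (h.coord α) := rfl

theorem val_mul (g h : S.TransfiniteProduct a) (α : Ordinal.{u}) :
    (g * h).val α = g.val α * g.phiPrev α (h.val α) := by
  unfold val
  split_ifs with hα
  · rfl
  · simp

theorem phi_mul (g h : S.TransfiniteProduct a) {α : Ordinal.{u}} (hα : α < κ.ord) :
    (g * h).phi α = g.phi α * h.phi α := by
  induction α using Ordinal.limitRecOn with
  | zero => simp [val_mul, phiPrev]
  | add_one α ih =>
    have h0 : α + 1 ≠ 0 := (Order.bot_lt_succ α).ne'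
    rw [phi_add_one, phi_add_one, phi_add_one,
      ih ((Order.lt_add_one_iff.2 le_rfl).trans hα), val_mul, phiPrev, if_neg h0,
      Ordinal.pred_add_one, map_mul]
    ext x
    simp [MulAut.mul_apply, MulAut.conj_apply, mul_assoc]
  | limit γ hl ih =>
    obtain ⟨s, hs⟩ := g.exists_isGluing_phi hα hl
    obtain ⟨t, ht⟩ := h.exists_isGluing_phi hα hl
    have hst : S.IsGluing a γ (fun β _ => (g * h).phi β) (s * t) := by
      intro β hβ x hx
      have h1 : h.phi β x ∈ S.level (a.enum β) := (h.phi_mem_iff le_rfl (hβ.trans hα) _).2 hx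
      have h2 := ht β hβ x hx
      simp only at h2 ⊢
      rw [ih β hβ (hβ.trans hα), Equiv.Perm.mul_apply, hs β hβ (t x) (h2 ▸ h1), h2]
      rfl
    rw [phi_limit _ hl, phi_limit _ hl, phi_limit _ hl, S.gluedElement_eq a hα hl hs,
      S.gluedElement_eq a hα hl ht, S.gluedElement_eq a hα hl hst, map_mul, Subgroup.coe_mul,
      map_mul]

theorem phiPrev_mul (g h : S.TransfiniteProduct a) {α : Ordinal.{u}} (hα : α < κ.ord) :
    (g * h).phiPrev α = g.phiPrev α * h.phiPrev α := by
  unfold phiPrev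
  split_ifs
  · rfl
  · exact phi_mul g h ((Ordinal.pred_le_self α).trans_lt hα)

/-- The group `𝒢_A`: the families `(g_α)` with the multiplication
`(g * h)_α = g_α * Φ^g_{α-1}(h_α)`. -/
noncomputable instance : Group (S.TransfiniteProduct a) :=
  Group.ofRightAxioms
    (by
      intro g h k
      ext α
      simp only [coord_mul, phiPrev_mul g h α.2.1, map_mul, mul_assoc, MulAut.mul_apply])
    (by
      intro g
      ext α
      have : ((1 : S.TransfiniteProduct a).coord α : G) = 1 := rfl
      rw [coord_mul, this, map_one, mul_one])
    (by
      intro g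
      ext α
      have h1 : ((1 : S.TransfiniteProduct a).coord α : G) = 1 := rfl
      have h2 : ((g⁻¹).coord α : G) = (g.phiPrev α)⁻¹ ((g.coord α)⁻¹ : S.component a α) := rfl
      rw [coord_mul, h1, h2, MulAut.apply_inv_self]
      simp)

/-- The limit `Φ = lim_{α < κ} Φ_α ↾ G_{a_α}` as a map: `Φ x = Φ_α x` for any `α < κ` with
`x ∈ G_{a_α}`. -/
noncomputable def limitFun (g : S.TransfiniteProduct a) (x : G) : G :=
  g.phi (S.exists_mem_level_enum a x).choose x

theorem limitFun_eq (g : S.TransfiniteProduct a) {α : Ordinal.{u}} (hα : α < κ.ord) {x : G}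
    (hx : x ∈ S.level (a.enum α)) : g.limitFun x = g.phi α x :=
  g.phi_eq_phi (S.exists_mem_level_enum a x).choose_spec.1 hα
    (S.exists_mem_level_enum a x).choose_spec.2 hx

theorem limitFun_mul (g : S.TransfiniteProduct a) (x y : G) :
    g.limitFun (x * y) = g.limitFun x * g.limitFun y := by
  obtain ⟨α, hα, hx⟩ := S.exists_mem_level_enum a x
  obtain ⟨β, hβ, hy⟩ := S.exists_mem_level_enum a y
  have hm : max α β < κ.ord := max_lt hα hβ
  have hx' := S.level_enum_mono a (le_max_left α β) hm hx
  have hy' := S.level_enum_mono a (le_max_right α β) hm hy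
  rw [g.limitFun_eq hm (mul_mem hx' hy'), g.limitFun_eq hm hx', g.limitFun_eq hm hy', map_mul]

theorem limitFun_bijective (g : S.TransfiniteProduct a) : Function.Bijective g.limitFun := by
  constructor
  · intro x y hxy
    obtain ⟨α, hα, hx⟩ := S.exists_mem_level_enum a x
    obtain ⟨β, hβ, hy⟩ := S.exists_mem_level_enum a y
    have hm : max α β < κ.ord := max_lt hα hβ
    rw [g.limitFun_eq hm (S.level_enum_mono a (le_max_left α β) hm hx),
      g.limitFun_eq hm (S.level_enum_mono a (le_max_right α β) hm hy)] at hxy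
    exact (g.phi _).injective hxy
  · intro y
    obtain ⟨α, hα, hy⟩ := S.exists_mem_level_enum a y
    refine ⟨(g.phi α)⁻¹ y, ?_⟩
    rw [g.limitFun_eq hα, MulAut.apply_inv_self]
    rw [← g.phi_mem_iff le_rfl hα, MulAut.apply_inv_self]
    exact hy

/-- The limit `Φ = lim_{α < κ} Φ_α ↾ G_{a_α}` as an automorphism of `G`. -/
noncomputable def limitAut (g : S.TransfiniteProduct a) : MulAut G :=
  MulEquiv.ofBijective (MulHom.mk g.limitFun g.limitFun_mul) g.limitFun_bijective

theorem limitAut_apply (g : S.TransfiniteProduct a) {α : Ordinal.{u}} (hα : α < κ.ord) {x : G}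
    (hx : x ∈ S.level (a.enum α)) : g.limitAut x = g.phi α x :=
  g.limitFun_eq hα hx

theorem limitAut_mem (g : S.TransfiniteProduct a) : g.limitAut ∈ S.levelPreservingAut A := by
  intro δ hδ
  have : (δ : Ordinal.{u}) ∈ a.enum '' Set.Iio κ.ord := a.image_eq ▸ ⟨δ, hδ, rfl⟩
  obtain ⟨α, hα, hαδ⟩ := this
  rw [← hαδ]
  ext y
  constructor
  · rintro ⟨x, hx, rfl⟩
    rw [g.limitAut_apply hα hx]
    exact (g.phi_mem_iff le_rfl hα x).2 hx
  · intro hy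
    have hx : (g.phi α)⁻¹ y ∈ S.level (a.enum α) := by
      rw [← g.phi_mem_iff le_rfl hα, MulAut.apply_inv_self]
      exact hy
    exact ⟨_, hx, by rw [g.limitAut_apply hα hx, MulAut.apply_inv_self]⟩

/-- The map `Θ : 𝒢_A → Aut_A(G)`, `Θ(g) = Φ^g`. -/
noncomputable def theta (g : S.TransfiniteProduct a) : S.levelPreservingAut A :=
  ⟨g.limitAut, g.limitAut_mem⟩

end TransfiniteProduct

end RegularRepLimit

/-! `Θ` is multiplicative because each `Φ_α` is (`phi_mul`) and `Φ_α` preserves the level on which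
it computes the limit. Bijectivity rests on two facts about `Sym(X)` with `|X| ≥ 7`: its centre is
trivial and all its automorphisms are inner. For non-limit `α` the ordinal `a_α` is `0` or a
successor by hypothesis, so `G_{a_α}` is such a symmetric group.

Injectivity: if `Φ^g = 1`, then by induction all earlier `Φ_β` are trivial, so at a non-limit `α`
conjugation by `g_α` is trivial on `G_{a_α}` and `g_α` is central there, hence `1`. At a limit, the
gluing of identities is the identity.

Surjectivity: given `φ`, pick `k_α` whose conjugation agrees with `φ` on `G_{a_α}`. For non-limit
`α` it can be taken in `G_{a_α}`, since automorphisms are inner; for limit `α` it is the permutation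
`φ` induces on `G_{a_α}`, an element of `G_{a_α + 1}`. Put `g_0 = k_0` and `g_{α+1} = k_{α+1}
k_α⁻¹`. The latter centralizes `G_{a_α}`, as both factors induce `φ` there, and the product
telescopes to `Φ_α = ι_{k_α}`.

That automorphisms of `Sym(X)` are inner follows from a group-theoretic description of
transpositions (`IsBraidInvolution`): automorphisms then permute transpositions, and the star of
transpositions through a point goes to the star through another point, which defines the conjugating
permutation. -/

namespace Equiv.Perm

/-! ### Characterising transpositions in a symmetric group -/

variable {X : Type*}

/-- Conjugating `swap x z` by `h` gives `swap (h x) (h z)`. If `h` moves `x` and `z` avoids `x` and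
`h x`, only the second of these moves `h x`. Here and below `hX` expresses that `X` has at least
seven points. -/
theorem eq_one_of_commute_swap [DecidableEq X] (hX : ∀ s : Finset X, s.card < 7 → ∃ x, x ∉ s)
    (h : Perm X) (hh : ∀ x y : X, h * swap x y = swap x y * h) : h = 1 := by
  ext x
  by_contra hx
  simp only [coe_one, id_eq] at hx
  obtain ⟨z, hz⟩ := hX {x, h x} (Finset.card_le_two.trans_lt (by norm_num))
  simp only [Finset.mem_insert, Finset.mem_singleton, not_or] at hz
  have key : swap x z = swap (h x) (h z) := by
    rw [swap_apply_apply, hh, mul_inv_cancel_right]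
  have := congrArg (fun g : Perm X => g (h x)) key
  simp only [swap_apply_left, swap_apply_of_ne_of_ne hx (Ne.symm hz.2)] at this
  exact hz.1 (h.injective this).symm

/-- A nontrivial involution that commutes with, or satisfies the braid relation with, each of its
conjugates. -/
def IsBraidInvolution {M : Type*} [Group M] (t : M) : Prop :=
  t ≠ 1 ∧ t * t = 1 ∧ ∀ g : M,
    t * (g * t * g⁻¹) = g * t * g⁻¹ * t ∨
      t * (g * t * g⁻¹) * t = g * t * g⁻¹ * t * (g * t * g⁻¹)

theorem IsBraidInvolution.map {M N : Type*} [Group M] [Group N] {t : M}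
    (ht : IsBraidInvolution t) (f : M ≃* N) : IsBraidInvolution (f t) := by
  refine ⟨fun h => ht.1 (f.injective (h.trans f.map_one.symm)), by rw [← map_mul, ht.2.1, map_one],
    fun g => ?_⟩
  obtain ⟨g, rfl⟩ := f.surjective g
  simp only [← map_mul, ← map_inv, f.injective.eq_iff]
  exact ht.2.2 g

variable [DecidableEq X]

theorem swap_mul_swap_comm_of_ne {a b c d : X} (hac : a ≠ c) (had : a ≠ d) (hbc : b ≠ c)
    (hbd : b ≠ d) : swap a b * swap c d = swap c d * swap a b := by
  rw [mul_swap_eq_swap_mul, swap_apply_of_ne_of_ne hac.symm hbc.symm,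
    swap_apply_of_ne_of_ne had.symm hbd.symm]

theorem swap_mul_swap_ne {x y z : X} (hxy : x ≠ y) (hxz : x ≠ z) (hyz : y ≠ z) :
    swap x y * swap x z ≠ swap x z * swap x y := by
  intro h
  have := congrArg (fun g : Perm X => g x) h
  simp only [mul_apply, swap_apply_left] at this
  rw [swap_apply_of_ne_of_ne hxz.symm hyz.symm, swap_apply_of_ne_of_ne hxy.symm hyz] at this
  exact hyz this.symm

theorem swap_braid {x y z : X} (hxy : x ≠ y) (hxz : x ≠ z) :
    swap x y * swap x z * swap x y = swap x z * swap x y * swap x z := by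
  by_cases hyz : y = z
  · rw [hyz]
  have h1 := swap_mul_swap_mul_swap (x := z) (y := x) (z := y) hxz.symm (Ne.symm hyz)
  have h2 := swap_mul_swap_mul_swap (x := y) (y := x) (z := z) hxy.symm hyz
  rw [swap_comm z x] at h1
  rw [swap_comm y x] at h2
  rw [h1, h2, swap_comm]

theorem isBraidInvolution_swap {a b : X} (hab : a ≠ b) : IsBraidInvolution (swap a b) := by
  refine ⟨fun h => hab (swap_eq_one_iff.1 h), swap_mul_self a b, fun g => ?_⟩
  rw [← swap_apply_apply]
  have hcd : g a ≠ g b := g.injective.ne hab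
  generalize g a = c at hcd ⊢
  generalize g b = d at hcd ⊢
  by_cases hac : a = c
  · subst hac; exact Or.inr (swap_braid hab hcd)
  by_cases had : a = d
  · subst had; rw [swap_comm c]; exact Or.inr (swap_braid hab hcd.symm)
  by_cases hbc : b = c
  · subst hbc; rw [swap_comm a]; exact Or.inr (swap_braid hab.symm hcd)
  by_cases hbd : b = d
  · subst hbd; rw [swap_comm a, swap_comm c]; exact Or.inr (swap_braid hab.symm hcd.symm)
  exact Or.inl (swap_mul_swap_comm_of_ne hac had hbc hbd)

/-- Two 2-cycles and a fixed point of `t` line up as a path `a, t a, c, t c, e`. A conjugate of `t`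
pairs this path in the complementary way, so its product with `t` has a 5-cycle, whereas commuting
or braiding would make the order divide 2 or 3. -/
theorem not_isBraidInvolution_of_fixed {t : Perm X} {a c e : X} (ht : t * t = 1)
    (hta : t a ≠ a) (htc : t c ≠ c) (hte : t e = e) (hac : a ≠ c) (htac : t a ≠ c) :
    ¬ IsBraidInvolution t := by
  rintro ⟨-, -, h⟩
  have htt : ∀ x, t (t x) = x := fun x => congrArg (fun g : Perm X => g x) ht
  have hae : a ≠ e := by rintro rfl; exact hta hte
  have hce : c ≠ e := by rintro rfl; exact htc hte
  have hbe : t a ≠ e := fun h => hae (by grind)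
  have hde : t c ≠ e := fun h => htc (by grind)
  have had : a ≠ t c := by grind
  have hbd : t a ≠ t c := t.injective.ne hac
  -- The 5-cycle that moves each point of the path one place on.
  let g : Perm X := swap a (t a) * (swap (t a) c * (swap c (t c) * swap (t c) e))
  have ga : g a = t a := by simp only [g, mul_apply, swap_apply_def]; grind
  have gb : g (t a) = c := by simp only [g, mul_apply, swap_apply_def]; grind
  have gc : g c = t c := by simp only [g, mul_apply, swap_apply_def]; grind
  have gd : g (t c) = e := by simp only [g, mul_apply, swap_apply_def]; grind
  have ge : g e = a := by simp only [g, mul_apply, swap_apply_def]; grind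
  have hs : ∀ x, (g * t * g⁻¹) (g x) = g (t x) := fun x => by simp
  have hsa : (g * t * g⁻¹) a = a := by rw [← ge, hs, hte]
  have hsb : (g * t * g⁻¹) (t a) = c := by have := hs a; rwa [ga, gb] at this
  rcases h g with h | h
  · have := congrArg (fun g : Perm X => g a) h
    rw [mul_apply, hsa, mul_apply, hsb] at this
    exact htac this
  · have := congrArg (fun g : Perm X => g a) h
    rw [mul_apply, mul_apply, hsb, mul_apply, mul_apply, hsa, hsb] at this
    exact htc this

/-- Same idea on a closed octagon `a, t a, b, t b, c, t c, d, t d`: rotating by one step conjugates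
`t` into the complementary matching of the edges, and the product of the two matchings acts with
order 4. -/
theorem not_isBraidInvolution_of_four {t : Perm X} {a b c d : X} (ht : t * t = 1)
    (hta : t a ≠ a) (htb : t b ≠ b) (htc : t c ≠ c) (htd : t d ≠ d)
    (hb : b ≠ a ∧ b ≠ t a) (hc : c ≠ a ∧ c ≠ t a ∧ c ≠ b ∧ c ≠ t b)
    (hd : d ≠ a ∧ d ≠ t a ∧ d ≠ b ∧ d ≠ t b ∧ d ≠ c ∧ d ≠ t c) :
    ¬ IsBraidInvolution t := by
  rintro ⟨-, -, h⟩
  have htt : ∀ x, t (t x) = x := fun x => congrArg (fun g : Perm X => g x) ht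
  have hab : t b ≠ a ∧ t b ≠ t a := by grind
  have hac : t c ≠ a ∧ t c ≠ t a ∧ t c ≠ b ∧ t c ≠ t b := by grind
  have had : t d ≠ a ∧ t d ≠ t a ∧ t d ≠ b ∧ t d ≠ t b ∧ t d ≠ c ∧ t d ≠ t c := by grind
  let g : Perm X := swap a (t a) * (swap (t a) b * (swap b (t b) * (swap (t b) c *
    (swap c (t c) * (swap (t c) d * swap d (t d))))))
  have g1 : g a = t a := by simp only [g, mul_apply, swap_apply_def]; grind
  have g2 : g (t a) = b := by simp only [g, mul_apply, swap_apply_def]; grind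
  have g5 : g c = t c := by simp only [g, mul_apply, swap_apply_def]; grind
  have g6 : g (t c) = d := by simp only [g, mul_apply, swap_apply_def]; grind
  have g7 : g d = t d := by simp only [g, mul_apply, swap_apply_def]; grind
  have g8 : g (t d) = a := by simp only [g, mul_apply, swap_apply_def]; grind
  have hs : ∀ x, (g * t * g⁻¹) (g x) = g (t x) := fun x => by simp
  have s1 : (g * t * g⁻¹) a = t d := by rw [← g8, hs, htt, g7]
  have s2 : (g * t * g⁻¹) (t a) = b := by have := hs a; rwa [g1, g2] at this
  have s7 : (g * t * g⁻¹) d = t c := by rw [← g6, hs, htt, g5]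
  rcases h g with h | h
  · have := congrArg (fun g : Perm X => g a) h
    rw [mul_apply, s1, mul_apply, s2, htt] at this
    exact hd.2.2.1 this
  · have := congrArg (fun g : Perm X => g a) h
    rw [mul_apply, mul_apply, s2, mul_apply, mul_apply, s1, htt, s7] at this
    exact hac.2.2.2 this.symm

theorem IsBraidInvolution.isSwap (hX : ∀ s : Finset X, s.card < 7 → ∃ x, x ∉ s) {t : Perm X}
    (ht : IsBraidInvolution t) : t.IsSwap := by
  have htt : ∀ x, t (t x) = x := fun x => congrArg (fun g : Perm X => g x) ht.2.1
  obtain ⟨a, hta⟩ : ∃ a, t a ≠ a := by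
    by_contra! h
    exact ht.1 (Equiv.ext h)
  by_cases hfix : ∃ e, t e = e
  · obtain ⟨e, hte⟩ := hfix
    refine ⟨a, t a, hta.symm, ?_⟩
    ext x
    by_cases hxa : x = a
    · rw [hxa, swap_apply_left]
    by_cases hxb : x = t a
    · rw [hxb, swap_apply_right, htt]
    rw [swap_apply_of_ne_of_ne hxa hxb]
    by_contra htx
    exact not_isBraidInvolution_of_fixed ht.2.1 hta htx hte (Ne.symm hxa) (Ne.symm hxb) ht
  -- Without fixed points, a point outside three 2-cycles supplies a fourth; this is where seven
  -- points are needed. On six points a product of three disjoint transpositions is also a braid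
  -- involution, reflecting the outer automorphism of `Sym(6)`.
  · push Not at hfix
    obtain ⟨b, hb⟩ := hX {a, t a} (Finset.card_le_two.trans_lt (by norm_num))
    obtain ⟨c, hc⟩ := hX {a, t a, b, t b} (Finset.card_le_four.trans_lt (by norm_num))
    obtain ⟨d, hd⟩ := hX {a, t a, b, t b, c, t c} (Finset.card_le_six.trans_lt (by norm_num))
    simp only [Finset.mem_insert, Finset.mem_singleton, not_or] at hb hc hd
    exact absurd ht (not_isBraidInvolution_of_four ht.2.1 (hfix a) (hfix b) (hfix c) (hfix d)
      hb hc hd)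

/-! ### From the action on transpositions to an inner automorphism -/

theorem isSwap_map (hX : ∀ s : Finset X, s.card < 7 → ∃ x, x ∉ s) (f : MulAut (Perm X))
    {x y : X} (hxy : x ≠ y) : (f (swap x y)).IsSwap :=
  ((isBraidInvolution_swap hxy).map f).isSwap hX

theorem exists_common_of_not_commute {s t : Perm X} (hs : s.IsSwap) (ht : t.IsSwap)
    (h : s * t ≠ t * s) :
    ∃ p q r : X, p ≠ q ∧ p ≠ r ∧ q ≠ r ∧ s = swap p q ∧ t = swap p r := by
  obtain ⟨a, b, hab, rfl⟩ := hs
  obtain ⟨c, d, hcd, rfl⟩ := ht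
  by_cases hac : a = c
  · subst hac
    exact ⟨a, b, d, hab, hcd, by rintro rfl; exact h rfl, rfl, rfl⟩
  by_cases had : a = d
  · subst had
    exact ⟨a, b, c, hab, hcd.symm, by rintro rfl; exact h (by rw [swap_comm]), rfl, swap_comm _ _⟩
  by_cases hbc : b = c
  · subst hbc
    exact ⟨b, a, d, hab.symm, hcd, had, swap_comm _ _, rfl⟩
  by_cases hbd : b = d
  · subst hbd
    exact ⟨b, a, c, hab.symm, hcd.symm, hac, swap_comm _ _, swap_comm _ _⟩
  exact absurd (swap_mul_swap_comm_of_ne hac had hbc hbd) h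

/-- Distinct transpositions through `x` do not commute, so their images meet pairwise. Two of the
images are `(p q)` and `(p r)`; a third that meets both passes through `p` or is `(q r)`. -/
theorem exists_center_of_star (hX : ∀ s : Finset X, s.card < 7 → ∃ x, x ∉ s)
    (f : MulAut (Perm X)) (x : X) :
    ∃ p : X, ∀ y, x ≠ y → ∃ q, p ≠ q ∧ f (swap x y) = swap p q := by
  obtain ⟨y, hy⟩ := hX {x} (by simp)
  obtain ⟨z, hz⟩ := hX {x, y} (Finset.card_le_two.trans_lt (by norm_num))
  simp only [Finset.mem_insert, Finset.mem_singleton, not_or] at hy hz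
  have hne : ∀ {y z : X}, x ≠ y → x ≠ z → y ≠ z →
      f (swap x y) * f (swap x z) ≠ f (swap x z) * f (swap x y) := fun h1 h2 h3 h => by
    rw [← map_mul, ← map_mul] at h
    exact swap_mul_swap_ne h1 h2 h3 (f.injective h)
  obtain ⟨p, q, r, hpq, hpr, hqr, h1, h2⟩ := exists_common_of_not_commute
    (isSwap_map hX f (Ne.symm hy)) (isSwap_map hX f (Ne.symm hz.1))
    (hne (Ne.symm hy) (Ne.symm hz.1) (Ne.symm hz.2))
  refine ⟨p, fun w hw => ?_⟩
  by_cases hwy : w = y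
  · exact ⟨q, hpq, hwy ▸ h1⟩
  by_cases hwz : w = z
  · exact ⟨r, hpr, hwz ▸ h2⟩
  have h3 := hne (Ne.symm hy) hw (Ne.symm hwy)
  have h4 := hne (Ne.symm hz.1) hw (Ne.symm hwz)
  -- The triangle is excluded: `(q r)` is a conjugate of `(p q)` by `(p r)`, hence already the image
  -- of `(y z)`, which fixes `x`.
  have h5 : f (swap x w) ≠ swap q r := by
    intro h
    have : swap q r = f (swap y z) := by
      have e1 := swap_mul_swap_mul_swap (x := r) (y := p) (z := q) hpr.symm hqr.symm
      have e2 := swap_mul_swap_mul_swap (x := z) (y := x) (z := y) hz.1 hz.2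
      rw [← e1, ← e2, swap_comm r p, swap_comm z x, ← h1, ← h2, map_mul, map_mul]
    have h6 := congrArg (fun g : Perm X => g x) (f.injective (h.trans this))
    simp only [swap_apply_left, swap_apply_of_ne_of_ne (Ne.symm hy) (Ne.symm hz.1)] at h6
    exact hw h6.symm
  obtain ⟨u, v, huv, hs⟩ := isSwap_map hX f hw
  rw [hs, h1] at h3
  rw [hs, h2] at h4
  rw [hs] at h5 ⊢
  by_cases hpu : p = u
  · exact ⟨v, hpu ▸ huv, by rw [hpu]⟩
  by_cases hpv : p = v
  · exact ⟨u, hpv ▸ huv.symm, by rw [hpv, swap_comm]⟩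
  have h7 : q = u ∨ q = v := by
    by_contra! h
    exact h3 (swap_mul_swap_comm_of_ne hpu hpv h.1 h.2)
  have h8 : r = u ∨ r = v := by
    by_contra! h
    exact h4 (swap_mul_swap_comm_of_ne hpu hpv h.1 h.2)
  rcases h7 with rfl | rfl <;> rcases h8 with rfl | rfl
  · exact absurd rfl hqr
  · exact absurd rfl h5
  · exact absurd (swap_comm _ _) h5
  · exact absurd rfl hqr

theorem swap_eq_of_center {p q p' q' : X} (hpq : p ≠ q) (hpp : p ≠ p')
    (h : swap p q = swap p' q') : swap p q = swap p p' := by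
  have h1 := congrArg (fun g : Perm X => g p) h
  simp only [swap_apply_left] at h1
  have h2 : p = q' := by
    by_contra hne
    rw [swap_apply_of_ne_of_ne hpp hne] at h1
    exact hpq h1.symm
  rw [h, h2, swap_comm]

theorem exists_perm_map_swap (hX : ∀ s : Finset X, s.card < 7 → ∃ x, x ∉ s)
    (f : MulAut (Perm X)) : ∃ σ : Perm X, ∀ x y, f (swap x y) = swap (σ x) (σ y) := by
  choose σ hσ using exists_center_of_star hX f
  have hinj : Function.Injective σ := by
    intro x y hxy
    by_contra hne
    obtain ⟨z, hz⟩ := hX {x, y} (Finset.card_le_two.trans_lt (by norm_num))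
    obtain ⟨w, hw⟩ := hX {x, y, z} (Finset.card_le_three.trans_lt (by norm_num))
    simp only [Finset.mem_insert, Finset.mem_singleton, not_or] at hz hw
    obtain ⟨p, hp, h1⟩ := hσ x z (Ne.symm hz.1)
    obtain ⟨q, hq, h2⟩ := hσ y w (Ne.symm hw.2.1)
    rw [← hxy] at hq h2
    -- The disjoint transpositions `(x z)` and `(y w)` commute; if their images shared the centre `σ
    -- x = σ y`, they would have to coincide.
    have hc := swap_mul_swap_comm_of_ne hne (Ne.symm hw.1) hz.2 (Ne.symm hw.2.2)
    have hc' := congrArg f hc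
    rw [map_mul, map_mul, h1, h2] at hc'
    have hpq : p = q := by
      by_contra hpq
      exact swap_mul_swap_ne hp hq hpq hc'
    have h3 := f.injective (h1.trans (hpq ▸ h2.symm))
    have h4 := congrArg (fun g : Perm X => g x) h3
    simp only [swap_apply_left, swap_apply_of_ne_of_ne hne (Ne.symm hw.1)] at h4
    exact hz.1 h4
  have hswap : ∀ x y, f (swap x y) = swap (σ x) (σ y) := by
    intro x y
    by_cases hxy : x = y
    · subst hxy
      rw [swap_self, swap_self]
      exact map_one f
    obtain ⟨p, hp, h1⟩ := hσ x y hxy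
    obtain ⟨q, -, h2⟩ := hσ y x (Ne.symm hxy)
    rw [swap_comm y x, h1] at h2
    rw [h1]
    exact swap_eq_of_center hp (hinj.ne hxy) h2
  have hsurj : Function.Surjective σ := by
    intro p
    obtain ⟨q, hq⟩ := hX {p} (by simp)
    rw [Finset.mem_singleton] at hq
    obtain ⟨x, y, -, h⟩ := isSwap_map hX f.symm (Ne.symm hq)
    have h' : swap p q = swap (σ x) (σ y) := by
      rw [← hswap, ← h]
      exact (f.apply_symm_apply _).symm
    have h1 := congrArg (fun g : Perm X => g p) h'
    simp only [swap_apply_left] at h1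
    rcases eq_or_eq_of_swap_apply_ne_self (h1 ▸ hq : swap (σ x) (σ y) p ≠ p) with h2 | h2
    · exact ⟨x, h2.symm⟩
    · exact ⟨y, h2.symm⟩
  exact ⟨Equiv.ofBijective σ ⟨hinj, hsurj⟩, hswap⟩

/-- Every automorphism of the symmetric group of a set with at least seven elements is inner. -/
theorem exists_eq_conj (hX : ∀ s : Finset X, s.card < 7 → ∃ x, x ∉ s) (f : MulAut (Perm X)) :
    ∃ σ : Perm X, f = MulAut.conj σ := by
  obtain ⟨σ, hσ⟩ := exists_perm_map_swap hX f
  refine ⟨σ, MulEquiv.ext fun g => ?_⟩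
  have key : ∀ x y, f g * swap (σ x) (σ y) = swap (σ (g x)) (σ (g y)) * f g := fun x y => by
    rw [← hσ, ← map_mul, mul_swap_eq_swap_mul, map_mul, hσ]
  -- `f g` and `σ * g * σ⁻¹` act alike on transpositions by conjugation, so their discrepancy
  -- commutes with all of them.
  have h1 := eq_one_of_commute_swap hX (σ⁻¹ * f g * σ * g⁻¹) (fun x y => by
    have e1 : g⁻¹ * swap x y = swap (g⁻¹ x) (g⁻¹ y) * g⁻¹ := mul_swap_eq_swap_mul _ _ _
    have e2 : ∀ x y, σ * swap x y = swap (σ x) (σ y) * σ := mul_swap_eq_swap_mul _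
    have e3 : σ⁻¹ * swap (σ x) (σ y) = swap x y * σ⁻¹ := by
      rw [mul_swap_eq_swap_mul]; simp
    have e4 : f g * swap (σ (g⁻¹ x)) (σ (g⁻¹ y)) = swap (σ x) (σ y) * f g := by
      rw [key]; simp
    calc σ⁻¹ * f g * σ * g⁻¹ * swap x y = σ⁻¹ * (f g * (σ * (g⁻¹ * swap x y))) := by
          simp only [mul_assoc]
      _ = σ⁻¹ * (f g * swap (σ (g⁻¹ x)) (σ (g⁻¹ y))) * σ * g⁻¹ := by
          rw [e1, ← mul_assoc σ, e2]; simp only [mul_assoc]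
      _ = (σ⁻¹ * swap (σ x) (σ y)) * f g * σ * g⁻¹ := by rw [e4]; simp only [mul_assoc]
      _ = _ := by rw [e3]; simp only [mul_assoc])
  rw [mul_inv_eq_one] at h1
  have h2 : f g = σ * (σ⁻¹ * f g * σ) * σ⁻¹ := by group
  rw [MulAut.conj_apply, h2, h1]

end Equiv.Perm

/-! ### Transfer to groups isomorphic to symmetric groups -/

namespace MulEquiv

variable {H X : Type*} [Group H]

theorem exists_eq_conj_of_perm (e : H ≃* Equiv.Perm X)
    (hX : ∀ s : Finset X, s.card < 7 → ∃ x, x ∉ s) (f : MulAut H) :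
    ∃ h : H, f = MulAut.conj h := by
  classical
  obtain ⟨σ, hσ⟩ := Equiv.Perm.exists_eq_conj hX ((e.symm.trans f).trans e)
  refine ⟨e.symm σ, MulEquiv.ext fun x => e.injective ?_⟩
  simpa using DFunLike.congr_fun hσ (e x)

theorem eq_one_of_forall_commute_of_perm (e : H ≃* Equiv.Perm X)
    (hX : ∀ s : Finset X, s.card < 7 → ∃ x, x ∉ s) {h : H} (hh : ∀ x, h * x = x * h) : h = 1 := by
  classical
  refine e.injective ((Equiv.Perm.eq_one_of_commute_swap hX (e h) fun x y => ?_).trans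
    e.map_one.symm)
  rw [← e.apply_symm_apply (Equiv.swap x y), ← map_mul, hh, map_mul]

end MulEquiv

/-- The restriction of an automorphism to an invariant subgroup. -/
def MulAut.restrictSubgroup {G : Type*} [Group G] (φ : MulAut G) (L : Subgroup G)
    (h : ∀ x, φ x ∈ L ↔ x ∈ L) : MulAut L :=
  { Equiv.subtypeEquiv φ.toEquiv (fun x => (h x).symm) with
    map_mul' := fun x y => Subtype.ext (map_mul φ (x : G) y) }

theorem Function.Embedding.exists_notMem {X : Type*} {m : ℕ} (e : Fin m ↪ X) (s : Finset X)
    (hs : s.card < m) : ∃ x, x ∉ s := by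
  obtain ⟨x, -, hx⟩ := Finset.exists_mem_notMem_of_card_lt_card
    (s := s) (t := Finset.univ.map e) (by simpa using hs)
  exact ⟨x, hx⟩

/-! ### Conjugators for level preserving automorphisms -/

namespace RegularRepLimit

variable {κ : Cardinal.{u}} {n : ℕ} {G : Type u} [Group G] (S : RegularRepLimit κ n G)
  {A : Set (Set.Iio κ.ord)} (a : ClubEnumeration κ A)

theorem nonempty_embedding_level (hn : 7 ≤ n) {α : Ordinal.{u}} (hα : α < κ.ord) :
    Nonempty (Fin 7 ↪ S.level α) := by
  obtain ⟨e⟩ := S.base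
  have : NeZero n := ⟨by omega⟩
  -- The permutations `swap 0 i` are distinct elements of `Sym(n)`, and the base level lies in every
  -- level.
  exact ⟨((Fin.castLEEmb hn).trans ⟨_, Equiv.swap_injective_of_left (0 : Fin n)⟩).trans
    (e.symm.toEquiv.toEmbedding.trans
      ⟨_, Subgroup.inclusion_injective (S.level_mono 0 α zero_le hα)⟩)⟩

theorem exists_level_mulEquiv_perm (hn : 7 ≤ n) {α : Ordinal.{u}} (hα : α < κ.ord)
    (hl : ¬ IsSuccLimit α) :
    ∃ X : Type u, (∀ s : Finset X, s.card < 7 → ∃ x, x ∉ s) ∧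
      Nonempty (S.level α ≃* Equiv.Perm X) := by
  induction α using Ordinal.limitRecOn with
  | zero =>
    obtain ⟨e⟩ := S.base
    exact ⟨ULift (Fin n),
      ((Fin.castLEEmb hn).trans Equiv.ulift.symm.toEmbedding).exists_notMem,
      ⟨e.trans Equiv.ulift.symm.permCongrHom⟩⟩
  | add_one β _ =>
    have hβ : β < κ.ord := (Order.lt_add_one_iff.2 le_rfl).trans hα
    obtain ⟨i⟩ := S.nonempty_embedding_level hn hβ
    exact ⟨S.level β, i.exists_notMem, ⟨S.succEquiv β hβ⟩⟩
  | limit γ hγ _ => exact absurd hγ hl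

theorem eq_one_of_commute_level (hn : 7 ≤ n) {α : Ordinal.{u}} (hα : α < κ.ord)
    (hl : ¬ IsSuccLimit α) {k : G} (hk : k ∈ S.level α)
    (h : ∀ x ∈ S.level α, MulAut.conj k x = x) : k = 1 := by
  obtain ⟨X, hX, ⟨e⟩⟩ := S.exists_level_mulEquiv_perm hn hα hl
  refine congrArg Subtype.val (e.eq_one_of_forall_commute_of_perm hX (h := ⟨k, hk⟩) fun x => ?_)
  exact Subtype.ext (mul_inv_eq_iff_eq_mul.1 (h x x.2))

theorem exists_conj_eq_on_level (hn : 7 ≤ n) {α : Ordinal.{u}} (hα : α < κ.ord)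
    (hl : ¬ IsSuccLimit α) {φ : MulAut G} (hφ : ∀ x, φ x ∈ S.level α ↔ x ∈ S.level α) :
    ∃ k ∈ S.level α, ∀ x ∈ S.level α, MulAut.conj k x = φ x := by
  obtain ⟨X, hX, ⟨e⟩⟩ := S.exists_level_mulEquiv_perm hn hα hl
  obtain ⟨k, hk⟩ := e.exists_eq_conj_of_perm hX (φ.restrictSubgroup _ hφ)
  exact ⟨k, k.2, fun x hx => (congrArg Subtype.val (DFunLike.congr_fun hk (⟨x, hx⟩ : S.level α))).symm⟩

theorem apply_mem_level_enum_iff {φ : MulAut G} (hφ : φ ∈ S.levelPreservingAut A)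
    {α : Ordinal.{u}} (hα : α < κ.ord) (x : G) :
    φ x ∈ S.level (a.enum α) ↔ x ∈ S.level (a.enum α) := by
  obtain ⟨δ, hδ, h⟩ : a.enum α ∈ Subtype.val '' A := a.image_eq ▸ ⟨α, hα, rfl⟩
  have := hφ δ hδ
  rw [h] at this
  rw [← SetLike.mem_coe, ← SetLike.mem_coe]
  nth_rw 1 [← this]
  exact φ.injective.mem_set_image

/-- The permutation induced on `G_{a_γ}` by a level preserving automorphism, as an element of
`G_{a_γ + 1}`. -/
noncomputable def restrictElement (φ : S.levelPreservingAut A) {γ : Ordinal.{u}}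
    (hγ : γ < κ.ord) : S.level (a.enum γ + 1) :=
  (S.succEquiv (a.enum γ) (a.enum_lt hγ)).symm
    (φ.1.restrictSubgroup _ (S.apply_mem_level_enum_iff a φ.2 hγ)).toEquiv

theorem conj_restrictElement (φ : S.levelPreservingAut A) {γ : Ordinal.{u}} (hγ : γ < κ.ord)
    {x : G} (hx : x ∈ S.level (a.enum γ)) :
    MulAut.conj (S.restrictElement a φ hγ : G) x = φ.1 x :=
  S.conj_succEquiv_symm (a.enum_lt hγ) _
    (fun y z => map_mul (φ.1.restrictSubgroup _ (S.apply_mem_level_enum_iff a φ.2 hγ)) y z) ⟨x, hx⟩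

/-- The restriction of `φ` to `G_{a_γ}` is itself a gluing of the `f β`, and gluings at limits are
unique. -/
theorem gluedElement_eq_restrictElement (φ : S.levelPreservingAut A) {γ : Ordinal.{u}}
    (hγ : γ < κ.ord) (hl : IsSuccLimit γ) {f : ∀ β < γ, MulAut G}
    (hf : ∀ (β : Ordinal.{u}) (hβ : β < γ), ∀ x ∈ S.level (a.enum β), f β hβ x = φ.1 x) :
    S.gluedElement a γ f = S.restrictElement a φ hγ :=
  S.gluedElement_eq a hγ hl fun β hβ x hx => (hf β hβ x hx).symm

theorem level_enum_add_one_le {α : Ordinal.{u}} (hα : α + 1 < κ.ord) :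
    S.level (a.enum α + 1) ≤ S.level (a.enum (α + 1)) := by
  have hlt : α < α + 1 := Order.lt_add_one_iff.2 le_rfl
  exact S.level_mono _ _ (Order.add_one_le_of_lt
    (a.strictMonoOn (hlt.trans hα : α ∈ Set.Iio κ.ord) hα hlt)) (a.enum_lt hα)

/-- At limits the conjugator is prescribed exactly, not merely through its action on `G_{a_α}`, so
that it matches the element used in the recursion for `phi`. -/
theorem exists_conjugators (hn : 7 ≤ n)
    (ha : ∀ α < κ.ord, ¬ IsSuccLimit α → ¬ IsSuccLimit (a.enum α))
    (φ : S.levelPreservingAut A) :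
    ∃ k : Ordinal.{u} → G, ∀ (α : Ordinal.{u}) (hα : α < κ.ord),
      (∀ x ∈ S.level (a.enum α), MulAut.conj (k α) x = φ.1 x) ∧
      k α ∈ S.level (a.enum α + 1) ∧
      (¬ IsSuccLimit α → k α ∈ S.level (a.enum α)) ∧
      (IsSuccLimit α → k α = S.restrictElement a φ hα) := by
  have : ∀ α : Ordinal.{u}, ∃ k : G, ∀ (hα : α < κ.ord),
      (∀ x ∈ S.level (a.enum α), MulAut.conj k x = φ.1 x) ∧
      k ∈ S.level (a.enum α + 1) ∧
      (¬ IsSuccLimit α → k ∈ S.level (a.enum α)) ∧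
      (IsSuccLimit α → k = S.restrictElement a φ hα) := by
    intro α
    by_cases hα : α < κ.ord
    · by_cases hl : IsSuccLimit α
      · exact ⟨S.restrictElement a φ hα, fun _ => ⟨fun x hx => S.conj_restrictElement a φ hα hx,
          Subtype.mem _, fun h => absurd hl h, fun _ => rfl⟩⟩
      · obtain ⟨k, hk, hkφ⟩ := S.exists_conj_eq_on_level hn (a.enum_lt hα) (ha α hα hl)
          (S.apply_mem_level_enum_iff a φ.2 hα)
        exact ⟨k, fun _ => ⟨hkφ, S.level_le_add_one (a.enum_lt hα) hk, fun _ => hk,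
          fun h => absurd h hl⟩⟩
    · exact ⟨1, fun h => absurd h hα⟩
  choose k hk using this
  exact ⟨k, hk⟩

/-! ### Bijectivity of `Θ` -/

namespace TransfiniteProduct

variable {S a}

theorem phi_eq_one_of_limitAut_eq_one (hn : 7 ≤ n)
    (ha : ∀ α < κ.ord, ¬ IsSuccLimit α → ¬ IsSuccLimit (a.enum α))
    (g : S.TransfiniteProduct a) (hg : g.limitAut = 1) {α : Ordinal.{u}} (hα : α < κ.ord) :
    g.phi α = 1 ∧ g.val α = 1 := by
  -- Once the earlier factors have vanished, `g_β` acts on `G_{a_β}` as `Φ^g = 1`, hence is central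
  -- in `G_{a_β}`.
  have key : ∀ {β : Ordinal.{u}}, β < κ.ord → ¬ IsSuccLimit β →
      g.phi β = MulAut.conj (g.val β) → g.phi β = 1 ∧ g.val β = 1 := fun {β} hβ hl hphi => by
    have : g.val β = 1 := by
      refine S.eq_one_of_commute_level hn (a.enum_lt hβ) (ha β hβ hl) (g.val_mem β).1
        fun x hx => ?_
      rw [← hphi, ← g.limitAut_apply hβ hx, hg, MulAut.one_apply]
    exact ⟨by rw [hphi, this, map_one], this⟩
  induction α using Ordinal.limitRecOn with
  | zero => exact key hα not_isSuccLimit_bot g.phi_zero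
  | add_one α ih =>
    refine key hα (Order.not_isSuccLimit_add_one α) ?_
    rw [phi_add_one, (ih ((Order.lt_add_one_iff.2 le_rfl).trans hα)).1, mul_one]
  | limit γ hl ih =>
    constructor
    · rw [phi_limit g hl, S.gluedElement_eq a hα hl (s := 1)]
      · simp
      · intro β hβ x _
        simp [(ih β hβ (hβ.trans hα)).1]
    -- A limit ordinal is not an index, so `val` takes its default value `1`.
    · rw [val, dif_neg fun h => h.2 hl]

theorem eq_one_of_limitAut_eq_one (hn : 7 ≤ n)
    (ha : ∀ α < κ.ord, ¬ IsSuccLimit α → ¬ IsSuccLimit (a.enum α))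
    (g : S.TransfiniteProduct a) (hg : g.limitAut = 1) : g = 1 := by
  ext α
  have h := (g.phi_eq_one_of_limitAut_eq_one hn ha hg α.2.1).2
  rw [val, dif_pos α.2] at h
  exact h

theorem limitAut_mul (g h : S.TransfiniteProduct a) :
    (g * h).limitAut = g.limitAut * h.limitAut := by
  ext x
  obtain ⟨α, hα, hx⟩ := S.exists_mem_level_enum a x
  rw [limitAut_apply _ hα hx, phi_mul g h hα, MulAut.mul_apply, MulAut.mul_apply,
    limitAut_apply h hα hx, limitAut_apply g hα ((h.phi_mem_iff le_rfl hα x).2 hx)]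

variable (S a) in
/-- `Θ` as a homomorphism of groups. -/
noncomputable def thetaHom : S.TransfiniteProduct a →* S.levelPreservingAut A :=
  MonoidHom.mk' theta fun g h => Subtype.ext (limitAut_mul g h)

theorem thetaHom_injective (hn : 7 ≤ n)
    (ha : ∀ α < κ.ord, ¬ IsSuccLimit α → ¬ IsSuccLimit (a.enum α)) :
    Function.Injective (thetaHom S a) :=
  (injective_iff_map_eq_one _).2 fun g hg =>
    g.eq_one_of_limitAut_eq_one hn ha (congrArg Subtype.val hg)

theorem thetaHom_surjective (hn : 7 ≤ n)
    (ha : ∀ α < κ.ord, ¬ IsSuccLimit α → ¬ IsSuccLimit (a.enum α)) :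
    Function.Surjective (thetaHom S a) := by
  intro φ
  obtain ⟨k, hk⟩ := S.exists_conjugators a hn ha φ
  -- Forced by the aim `Φ_α = ι_{k α}`. The values at limit `α` are irrelevant, as they are not
  -- coordinates.
  let c : Ordinal.{u} → G := fun α => if α = 0 then k 0 else k α * (k (Ordinal.pred α))⁻¹
  have c_add_one : ∀ α, c (α + 1) = k (α + 1) * (k α)⁻¹ := fun α => by
    have h0 : α + 1 ≠ 0 := (Order.bot_lt_succ α).ne'
    simp only [c, if_neg h0, Ordinal.pred_add_one]
  have c_mem : ∀ α : Ordinal.{u}, α < κ.ord → ¬ IsSuccLimit α → c α ∈ S.component a α := by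
    intro α hα hl
    induction α using Ordinal.limitRecOn with
    | zero =>
      refine Subgroup.mem_inf.2 ⟨?_, ?_⟩
      · simpa [c] using (hk 0 hα).2.2.1 hl
      · rw [Subgroup.mem_centralizer_iff]
        intro y hy
        simp only [prevLevel, if_true, SetLike.mem_coe, Subgroup.mem_bot] at hy
        rw [hy, one_mul, mul_one]
    | add_one α _ =>
      have hlt : α < α + 1 := Order.lt_add_one_iff.2 le_rfl
      have hα' : α < κ.ord := hlt.trans hα
      have h0 : α + 1 ≠ 0 := (Order.bot_lt_succ α).ne'
      rw [c_add_one]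
      -- If `α` is a limit, `k α` is only known to lie in `G_{a_α + 1}`; this suffices because `a_α
      -- + 1 ≤ a_{α+1}`.
      refine Subgroup.mem_inf.2 ⟨mul_mem ((hk _ hα).2.2.1 hl)
        (inv_mem (S.level_enum_add_one_le a hα (hk α hα').2.1)), ?_⟩
      rw [Subgroup.mem_centralizer_iff]
      intro y hy
      simp only [prevLevel, if_neg h0, Ordinal.pred_add_one, SetLike.mem_coe] at hy
      -- Conjugation by `k α` and by `k (α + 1)` both carry `φ⁻¹ y` to `y`, so the quotient commutes
      -- with `y`.
      have hz : φ.1⁻¹ y ∈ S.level (a.enum α) := by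
        rw [← S.apply_mem_level_enum_iff a φ.2 hα', MulAut.apply_inv_self]
        exact hy
      have h1 := (hk α hα').1 _ hz
      have h2 := (hk _ hα).1 _ (S.level_enum_mono a hlt.le hα hz)
      rw [MulAut.apply_inv_self, MulAut.conj_apply] at h1 h2
      generalize φ.1⁻¹ y = z at h1 h2
      have h3 : (k α)⁻¹ * y = z * (k α)⁻¹ := by rw [← h1]; group
      have h4 : k (α + 1) * z = y * k (α + 1) := by rw [← h2]; group
      rw [mul_assoc _ _ y, h3, ← mul_assoc, ← mul_assoc, h4]
    | limit γ hγ _ => exact absurd hγ hl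
  let g : S.TransfiniteProduct a := ⟨fun α => ⟨c α, c_mem α α.2.1 α.2.2⟩⟩
  have g_val : ∀ α : Ordinal.{u}, α < κ.ord → ¬ IsSuccLimit α → g.val α = c α :=
    fun α hα hl => by rw [val, dif_pos ⟨hα, hl⟩]
  have g_phi : ∀ α : Ordinal.{u}, α < κ.ord → g.phi α = MulAut.conj (k α) := by
    intro α hα
    induction α using Ordinal.limitRecOn with
    | zero =>
      rw [phi_zero, g_val 0 hα not_isSuccLimit_bot]
      simp [c]
    | add_one α ih =>
      rw [phi_add_one, ih ((Order.lt_add_one_iff.2 le_rfl).trans hα),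
        g_val _ hα (Order.not_isSuccLimit_add_one α), c_add_one, ← map_mul, inv_mul_cancel_right]
    | limit γ hl ih =>
      rw [phi_limit g hl, (hk γ hα).2.2.2 hl]
      congr 1
      refine S.gluedElement_eq_restrictElement a φ hα hl fun β hβ x hx => ?_
      rw [ih β hβ (hβ.trans hα), (hk β (hβ.trans hα)).1 x hx]
  refine ⟨g, Subtype.ext (MulEquiv.ext fun x => ?_)⟩
  obtain ⟨α, hα, hx⟩ := S.exists_mem_level_enum a x
  exact (g.limitAut_apply hα hx).trans (by rw [g_phi α hα, (hk α hα).1 x hx])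

end TransfiniteProduct

end RegularRepLimit

theorem theorem2p6 {κ : Cardinal.{u}} {n : ℕ} (hn : 7 ≤ n) {G : Type u} [Group G]
    (S : RegularRepLimit κ n G) (A : Set (Set.Iio κ.ord)) (a : ClubEnumeration κ A)
    (ha : ∀ α < κ.ord, ¬ Order.IsSuccLimit α → ¬ Order.IsSuccLimit (a.enum α)) :
    ∃ e : S.TransfiniteProduct a ≃* S.levelPreservingAut A,
      ∀ g : S.TransfiniteProduct a, e g = g.theta :=
  ⟨MulEquiv.ofBijective (RegularRepLimit.TransfiniteProduct.thetaHom S a)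
    ⟨RegularRepLimit.TransfiniteProduct.thetaHom_injective hn ha,
      RegularRepLimit.TransfiniteProduct.thetaHom_surjective hn ha⟩, fun _ => rfl⟩
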